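/- Let $\Gamma$ be a finitely generated abelian group and let $\mathcal A=\{\alpha_1,\dots,\alpha_n\}$ be a finite list of elements of $\Gamma$ (repetitions allowed). Let $G$ be an abelian group that is torsion-wise finite, i.e. $G[d]=\{g\in G : dg=0\}$ is finite for every integer $d>0$, and divisible, i.e. multiplication by $k$ is surjective on $G$ for every integer $k>0$. For a sublist $\mathcal S\subset\mathcal A$ let $r_{\mathcal S}$ be the rank of the subgroup $\langle\mathcal S\rangle\subset\Gamma$ generated by $\mathcal S$, let $m(\mathcal S;G)=\#\operatorname{Hom}\big((\Gamma/\langle\mathcal S\rangle)_{\mathrm{tor}},G\big)$, where $(\cdot)_{\mathrm{tor}}$ denotes the torsion subgroup, and let $$T_{\mathcal A}^G(x,y)=\sum_{\mathcal S\subset\mathcal A} m(\mathcal S;G)\,(x-1)^{r_{\mathcal A}-r_{\mathcal S}}(y-1)^{\#\mathcal S-r_{\mathcal S}}$$ be the $G$-Tutte polynomial. Then the coefficients of $T_{\mathcal A}^G(x,y)$ are positive integers, in the sense that the coefficient of every monomial $x^iy^j$ that occurs in $T_{\mathcal A}^G(x,y)$ (i.e. every nonzero coefficient) is a positive integer. Equivalently,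 $T_{\mathcal A}^G(x,y)$ has nonnegative integer coefficients. -/

import Mathlib

namespace GTutte

/-- An abelian group `G` is torsion-wise finite if its subgroup `G[d]` of `d`-torsion points
is finite for every positive integer `d`. -/
def TorsionWiseFinite (G : Type*) [AddCommGroup G] : Prop :=
  ∀ d : ℕ, 0 < d → {g : G | d • g = 0}.Finite

/-- An abelian group `G` is divisible if multiplication by `k` is surjective on `G`
for every positive integer `k`. -/
def IsDivisible (G : Type*) [AddCommGroup G] : Prop :=
  ∀ k : ℕ, 0 < k → Function.Surjective (fun g : G => k • g)

section

variable {ι Γ : Type*} [AddCommGroup Γ]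

/-- The subgroup `⟨S⟩` of `Γ` generated by the sublist of `A` with index set `S`. -/
def spanOf (A : ι → Γ) (S : Finset ι) : AddSubgroup Γ :=
  AddSubgroup.closure (A '' (S : Set ι))

/-- The rank `r_S` of the abelian group `⟨S⟩`. -/
noncomputable def rk (A : ι → Γ) (S : Finset ι) : ℕ :=
  Module.finrank ℤ (spanOf A S)

/-- The `G`-multiplicity `m(S; G)`, the number of homomorphisms `(Γ/⟨S⟩)_tor → G`. -/
noncomputable def multiplicity (A : ι → Γ) (G : Type*) [AddCommGroup G] (S : Finset ι) : ℕ :=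
  Nat.card (AddCommGroup.torsion (Γ ⧸ spanOf A S) →+ G)

theorem rk_le_card (A : ι → Γ) (S : Finset ι) : rk A S ≤ S.card := by
  classical
  have h : AddSubgroup.toIntSubmodule (spanOf A S)
      = Submodule.span ℤ ((S.image A : Finset Γ) : Set Γ) := by
    rw [spanOf, AddSubgroup.toIntSubmodule_closure, Finset.coe_image]
  have h' : rk A S = Module.finrank ℤ (AddSubgroup.toIntSubmodule (spanOf A S)) := rfl
  rw [h', h]
  exact (finrank_span_finset_le_card _).trans Finset.card_image_le

variable [Fintype ι]

theorem rk_le_rk_univ (A : ι → Γ) (S : Finset ι) : rk A S ≤ rk A Finset.univ := by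
  classical
  have hfg : AddSubgroup.toIntSubmodule (spanOf A (Finset.univ : Finset ι))
      = Submodule.span ℤ (((Finset.univ : Finset ι).image A : Finset Γ) : Set Γ) := by
    rw [spanOf, AddSubgroup.toIntSubmodule_closure, Finset.coe_image]
  have : Module.Finite ℤ (AddSubgroup.toIntSubmodule (spanOf A (Finset.univ : Finset ι))) := by
    rw [hfg]; infer_instance
  have hle : AddSubgroup.toIntSubmodule (spanOf A S)
      ≤ AddSubgroup.toIntSubmodule (spanOf A (Finset.univ : Finset ι)) :=
    AddSubgroup.toIntSubmodule.monotone
      (AddSubgroup.closure_mono (Set.image_mono (by simp)))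
  exact Submodule.finrank_mono hle

open MvPolynomial in
/-- The `G`-Tutte polynomial
`∑_{S ⊆ A} m(S; G) (x - 1)^(r_A - r_S) (y - 1)^(#S - r_S)` in the variables `x = X 0`, `y = X 1`.
The natural number subtractions are not truncated, by `rk_le_rk_univ` and `rk_le_card`. -/
noncomputable def tuttePolynomial (A : ι → Γ) (G : Type*) [AddCommGroup G] :
    MvPolynomial (Fin 2) ℤ :=
  ∑ S : Finset ι, C (multiplicity A G S : ℤ) *
    (X 0 - 1) ^ (rk A Finset.univ - rk A S) * (X 1 - 1) ^ (S.card - rk A S)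

end

end GTutte

/-! Write the polynomial as a sum over the interval `[∅, univ]` of sets. If some `e` in `S \ R` is
neither a loop over `R` nor a coloop of `S`, the sum over `[R, S]` splits into those over `[R, S \
e]` and `[R ∪ e, S]`, without signs (`intervalTutte_eq_add`). It remains to treat molecules: `S = R
∪ F ∪ T` with `F` coloops and `T` loops.

On a molecule the multiplicity factors as `m(R ∪ X ∪ Y) = a(F \ X) b(Y)`, so the sum is a polynomial
in `x` times one in `y`. Both `a` and `b` count supersets, and the binomial theorem turns such
counts into nonnegative coefficients (`CountsSupersets.sum_eq`).

For the factorization, view `m` as the number of maps to `G` from the saturation of a span that kill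
the span. Divisibility of `G` makes restriction to the saturation of `⟨R⟩` surjective
(`IsDivisible.natCard_killing`). The restricted maps give `b`: each vector of `Y` is one more
element to kill. The kernel gives `a`: it is `Hom(Q_X, G)` for a finite group `Q_X` of coordinates
modulo integers, cut out of `Q_F` by the vanishing of the coordinates in `F \ X`. Finite duality
replaces it by maps into `Q_X`, where vanishing coordinates can be counted. -/

namespace GTutte

open Finset MvPolynomial

/-! ### Deletion and contraction on intervals, down to molecules -/

section Combinatorics

variable {ι : Type*} [DecidableEq ι]

/-- `a` counts, with multiplicities, the supersets of a variable set inside the finite set `T`. -/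
def CountsSupersets (T : Finset ι) (a : Finset ι → ℕ) : Prop :=
  ∃ w : Finset ι → ℕ, ∀ Y ⊆ T, a Y = ∑ Z ∈ Icc Y T, w Z

theorem countsSupersets_natCard {Φ : Type*} [Finite Φ] (T : Finset ι) (t : Φ → Finset ι)
    (ht : ∀ φ, t φ ⊆ T) : CountsSupersets T (fun Y => Nat.card {φ : Φ // Y ⊆ t φ}) := by
  have := Fintype.ofFinite Φ
  refine ⟨fun Z => #{φ : Φ | t φ = Z}, fun Y _ => ?_⟩
  beta_reduce
  rw [Nat.card_eq_fintype_card, Fintype.card_subtype,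
    card_eq_sum_card_fiberwise (f := t) (t := Icc Y T)]
  · refine sum_congr rfl fun Z hZ => ?_
    congr 1
    ext φ
    simp only [mem_filter, mem_univ, true_and, and_iff_right_iff_imp]
    rintro rfl
    exact (mem_Icc.1 hZ).1
  · intro φ hφ
    simp only [coe_filter, mem_univ, true_and, Set.mem_ofPred_eq] at hφ
    simpa using ⟨hφ, ht φ⟩

theorem coeff_X_pow_nonneg {σ : Type*} (i : σ) (n : ℕ) (d : σ →₀ ℕ) :
    0 ≤ coeff d (X i ^ n : MvPolynomial σ ℤ) := by
  classical
  rw [coeff_X_pow]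
  split_ifs <;> simp

theorem coeff_mul_nonneg {σ : Type*} {p q : MvPolynomial σ ℤ} (hp : ∀ d, 0 ≤ coeff d p)
    (hq : ∀ d, 0 ≤ coeff d q) (d : σ →₀ ℕ) : 0 ≤ coeff d (p * q) := by
  classical
  rw [coeff_mul]
  exact sum_nonneg fun x _ => mul_nonneg (hp _) (hq _)

/-- Exchange the sums; by the binomial theorem the subsets `Y` of `Z` contribute `((z - 1) + 1) ^
#Z`. -/
theorem CountsSupersets.sum_eq {R : Type*} [CommRing R] {T : Finset ι} {a w : Finset ι → ℕ}
    (h : ∀ Y ⊆ T, a Y = ∑ Z ∈ Icc Y T, w Z) (z : R) :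
    ∑ Y ∈ T.powerset, (a Y : R) * (z - 1) ^ #Y = ∑ Z ∈ T.powerset, (w Z : R) * z ^ #Z := by
  have h1 : ∀ Y ∈ T.powerset, (a Y : R) * (z - 1) ^ #Y
      = ∑ Z ∈ Icc Y T, (w Z : R) * (z - 1) ^ #Y := fun Y hY => by
    rw [h Y (mem_powerset.1 hY), Nat.cast_sum, sum_mul]
  rw [sum_congr rfl h1, sum_comm' (t' := T.powerset) (s' := fun Z => Z.powerset)]
  · refine sum_congr rfl fun Z _ => ?_
    rw [← mul_sum]
    congr 1
    simpa using sum_pow_mul_eq_add_pow (z - 1) 1 Z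
  · intro Y Z
    simp only [mem_powerset, mem_Icc]
    constructor
    · tauto
    · exact fun h => ⟨h.1.trans h.2, h⟩

theorem CountsSupersets.coeff_sum_nonneg {σ : Type*} {T : Finset ι} {a : Finset ι → ℕ}
    (h : CountsSupersets T a) (i : σ) (d : σ →₀ ℕ) :
    0 ≤ coeff d (∑ Y ∈ T.powerset, (a Y : MvPolynomial σ ℤ) * (X i - 1) ^ #Y) := by
  obtain ⟨w, hw⟩ := h
  rw [CountsSupersets.sum_eq hw, coeff_sum]
  refine sum_nonneg fun Z _ => ?_
  rw [← map_natCast (C : ℤ →+* MvPolynomial σ ℤ), coeff_C_mul]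
  exact mul_nonneg (Int.natCast_nonneg _) (coeff_X_pow_nonneg _ _ _)

/-- The rank function of a matroid, on finite sets. -/
structure IsRankFunction (r : Finset ι → ℕ) : Prop where
  empty : r ∅ = 0
  le_insert : ∀ e A, r A ≤ r (insert e A)
  insert_le : ∀ e A, r (insert e A) ≤ r A + 1
  insert_eq : ∀ e A B, A ⊆ B → r (insert e A) = r A → r (insert e B) = r B

namespace IsRankFunction

variable {r : Finset ι → ℕ} (hr : IsRankFunction r)
include hr

theorem union_le (A B : Finset ι) : r (A ∪ B) ≤ r A + #B := by
  induction B using Finset.induction_on with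
  | empty => simp
  | insert e B he ih =>
    rw [union_insert, card_insert_of_notMem he]
    have := hr.insert_le e (A ∪ B)
    omega

theorem le_card (A : Finset ι) : r A ≤ #A := by
  simpa [hr.empty] using hr.union_le ∅ A

/-- By submodularity, an element of `T` stays a loop over any superset of `R`, and an element `e` of
`F` raises the rank of any subset of `S.erase e`. -/
theorem molecule {R S F T : Finset ι} (hF : ∀ e ∈ F, r (S.erase e) ≠ r S)
    (hT : ∀ e ∈ T, r (insert e R) = r R) (hS : R ∪ F ∪ T = S) (hRF : Disjoint R F)
    {X Y : Finset ι} (hX : X ⊆ F) (hY : Y ⊆ T) :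
    r (R ∪ X ∪ Y) = r R + #X := by
  induction Y using Finset.induction_on with
  | empty =>
    rw [union_empty]
    induction X using Finset.induction_on with
    | empty => simp
    | insert e X he ih =>
      have heF := hX (mem_insert_self e X)
      rw [union_insert, card_insert_of_notMem he, ← add_assoc,
        ← ih ((subset_insert _ _).trans hX)]
      refine le_antisymm (hr.insert_le _ _) (Nat.succ_le_of_lt ?_)
      refine lt_of_le_of_ne (hr.le_insert _ _) fun h => hF e heF ?_
      have h1 := hr.insert_eq e (R ∪ X) (S.erase e) ?_ h.symm
      · rw [← h1, insert_erase]
        rw [← hS]; simp [heF]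
      · intro x hx
        have hne : x ≠ e := by
          rintro rfl
          rcases mem_union.1 hx with h | h
          · exact disjoint_left.1 hRF h heF
          · exact he h
        rw [mem_erase, ← hS]
        refine ⟨hne, mem_union_left _ (union_subset_union_right ?_ hx)⟩
        exact (subset_insert _ _).trans hX
  | insert e Y _ ih =>
    rw [union_insert, hr.insert_eq e R (R ∪ X ∪ Y) ?_ (hT e (hY (mem_insert_self _ _))),
      ih ((subset_insert _ _).trans hY)]
    rw [union_assoc]; exact subset_union_left

end IsRankFunction

/-- The Tutte polynomial of the minor given by an interval `[R, S]` of sets, weighted by `m`. -/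
noncomputable def intervalTutte (r m : Finset ι → ℕ) (R S : Finset ι) : MvPolynomial (Fin 2) ℤ :=
  ∑ A ∈ Icc R S, (m A : MvPolynomial (Fin 2) ℤ) * (X 0 - 1) ^ (r S - r A) *
    (X 1 - 1) ^ (#A - r A - (#R - r R))

/-- Split by whether `e ∈ A`. The two rank hypotheses keep `r S` and the nullity `#R - r R`
unchanged, so both halves carry the same exponents. -/
theorem intervalTutte_eq_add {r m : Finset ι → ℕ} {R S : Finset ι} {e : ι}
    (heR : e ∉ R) (h1 : r (insert e R) = r R + 1) (h2 : r (S.erase e) = r S) :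
    intervalTutte r m R S
      = intervalTutte r m R (S.erase e) + intervalTutte r m (insert e R) S := by
  have hI : Icc R S = Icc R (S.erase e) ∪ Icc (insert e R) S := by
    ext A
    simp only [mem_union, mem_Icc, subset_erase, insert_subset_iff]
    tauto
  have hd : Disjoint (Icc R (S.erase e)) (Icc (insert e R) S) := by
    rw [disjoint_left]
    simp only [mem_Icc, subset_erase, insert_subset_iff]
    tauto
  unfold intervalTutte
  rw [hI, sum_union hd, h2, h1, card_insert_of_notMem heR]
  simp

theorem IsRankFunction.intervalTutte_coeff_nonneg_of_molecule {r m : Finset ι → ℕ}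
    (hr : IsRankFunction r) {R S F T : Finset ι} (hF : ∀ e ∈ F, r (S.erase e) ≠ r S)
    (hT : ∀ e ∈ T, r (insert e R) = r R) (hS : R ∪ F ∪ T = S) (hRF : Disjoint R F)
    (hRT : Disjoint R T) (hFT : Disjoint F T) {a b : Finset ι → ℕ} (ha : CountsSupersets F a)
    (hb : CountsSupersets T b)
    (hm : ∀ X ⊆ F, ∀ Y ⊆ T, m (R ∪ X ∪ Y) = a (F \ X) * b Y) (d : Fin 2 →₀ ℕ) :
    0 ≤ coeff d (intervalTutte r m R S) := by
  have key : intervalTutte r m R S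
      = (∑ X ∈ F.powerset, (a X : MvPolynomial (Fin 2) ℤ) * (MvPolynomial.X 0 - 1) ^ #X) *
        ∑ Y ∈ T.powerset, (b Y : MvPolynomial (Fin 2) ℤ) * (MvPolynomial.X 1 - 1) ^ #Y := by
    rw [sum_mul_sum, ← sum_product', intervalTutte]
    symm
    -- The exponent of `x - 1` is a corank, so `X` records the coloops missing from `A`.
    refine sum_nbij' (fun p => R ∪ (F \ p.1) ∪ p.2) (fun A => (F \ A, A ∩ T)) ?_ ?_ ?_ ?_ ?_
    · rintro ⟨X, Y⟩ h
      simp only [mem_product, mem_powerset] at h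
      rw [mem_Icc, ← hS]
      exact ⟨by rw [union_assoc]; exact subset_union_left,
        union_subset_union (union_subset_union_right sdiff_subset) h.2⟩
    · intro A _
      simp
    · rintro ⟨X, Y⟩ h
      simp only [mem_product, mem_powerset] at h
      rw [Finset.disjoint_left] at hRF hRT hFT
      ext x
      · have := @h.1 x
        have := @h.2 x
        have := @hRF x
        have := @hFT x
        simp only [mem_sdiff, mem_union]
        tauto
      · have := @h.1 x
        have := @h.2 x
        have := @hRT x
        have := @hFT x
        simp only [mem_inter, mem_sdiff, mem_union]
        tauto
    · intro A hA
      rw [mem_Icc, ← hS] at hA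
      ext x
      have h1 := @hA.1 x
      have h2 := @hA.2 x
      simp only [mem_inter, mem_sdiff, mem_union] at h2 ⊢
      tauto
    · rintro ⟨X, Y⟩ h
      simp only [mem_product, mem_powerset] at h
      have h1 : r (R ∪ (F \ X) ∪ Y) = r R + #(F \ X) :=
        hr.molecule hF hT hS hRF sdiff_subset h.2
      have h2 : r S = r R + #F := by
        rw [← hS]; exact hr.molecule hF hT hS hRF subset_rfl subset_rfl
      have h3 : #(R ∪ (F \ X) ∪ Y) = #R + #(F \ X) + #Y := by
        rw [card_union_of_disjoint, card_union_of_disjoint]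
        · exact hRF.mono_right sdiff_subset
        · exact disjoint_union_left.2 ⟨hRT.mono_right h.2, hFT.mono sdiff_subset h.2⟩
      have h4 := card_sdiff_add_card_eq_card h.1
      -- Keeps the subtraction `#R - r R` from truncating.
      have h5 := hr.le_card R
      simp only
      rw [hm _ sdiff_subset _ h.2, Finset.sdiff_sdiff_eq_self h.1, h1, h2, h3,
        show r R + #F - (r R + #(F \ X)) = #X by omega,
        show #R + #(F \ X) + #Y - (r R + #(F \ X)) - (#R - r R) = #Y by omega]
      push_cast
      ring
  rw [key]
  exact coeff_mul_nonneg (ha.coeff_sum_nonneg 0) (hb.coeff_sum_nonneg 1) d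

theorem IsRankFunction.intervalTutte_coeff_nonneg {r m : Finset ι → ℕ} (hr : IsRankFunction r)
    (hm : ∀ R S F T : Finset ι, (∀ e ∈ F, r (S.erase e) ≠ r S) →
      (∀ e ∈ T, r (insert e R) = r R) → R ∪ F ∪ T = S → Disjoint R F →
      ∃ a b : Finset ι → ℕ, CountsSupersets F a ∧ CountsSupersets T b ∧
        ∀ X ⊆ F, ∀ Y ⊆ T, m (R ∪ X ∪ Y) = a (F \ X) * b Y)
    (R S : Finset ι) (hRS : R ⊆ S) (d : Fin 2 →₀ ℕ) :
    0 ≤ coeff d (intervalTutte r m R S) := by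
  induction hn : #(S \ R) using Nat.strong_induction_on generalizing R S with
  | _ n ih =>
  by_cases h : ∃ e ∈ S \ R, r (insert e R) ≠ r R ∧ r (S.erase e) = r S
  · obtain ⟨e, he, h1, h2⟩ := h
    obtain ⟨heS, heR⟩ := mem_sdiff.1 he
    have h1' : r (insert e R) = r R + 1 := by
      have := hr.le_insert e R
      have := hr.insert_le e R
      omega
    rw [intervalTutte_eq_add heR h1' h2, coeff_add]
    refine add_nonneg (ih _ ?_ _ _ (subset_erase.2 ⟨hRS, heR⟩) rfl)
      (ih _ ?_ _ _ (insert_subset heS hRS) rfl)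
    · rw [← hn, erase_sdiff_comm]
      exact card_erase_lt_of_mem he
    · rw [← hn, sdiff_insert]
      exact card_erase_lt_of_mem he
  · push Not at h
    set T := {e ∈ S \ R | r (insert e R) = r R}
    set F := {e ∈ S \ R | ¬ r (insert e R) = r R}
    have hT : ∀ e ∈ T, r (insert e R) = r R := fun e he => (mem_filter.1 he).2
    have hF : ∀ e ∈ F, r (S.erase e) ≠ r S := fun e he =>
      h e (mem_filter.1 he).1 (mem_filter.1 he).2
    have hS : R ∪ F ∪ T = S := by
      rw [union_assoc, union_comm F T, filter_union_filter_not_eq, union_sdiff_of_subset hRS]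
    have hRF : Disjoint R F := disjoint_sdiff.mono_right (filter_subset _ _)
    have hRT : Disjoint R T := disjoint_sdiff.mono_right (filter_subset _ _)
    have hFT : Disjoint F T := (disjoint_filter_filter_not _ _ _).symm
    obtain ⟨a, b, ha, hb, hab⟩ := hm R S F T hF hT hS hRF
    exact hr.intervalTutte_coeff_nonneg_of_molecule hF hT hS hRF hRT hFT ha hb hab d

end Combinatorics

/-! ### Duality of finite abelian groups and divisible targets -/

section FiniteHom

/-- Each finite abelian group is isomorphic to its character group, and transposition is injective
because characters separate points. -/
theorem natCard_monoidHom_le {A B : Type*} [CommGroup A] [CommGroup B] [Finite A] [Finite B] :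
    Nat.card (A →* B) ≤ Nat.card (B →* A) := by
  obtain ⟨eA⟩ := CommGroup.monoidHom_mulEquiv_of_hasEnoughRootsOfUnity A ℂ
  obtain ⟨eB⟩ := CommGroup.monoidHom_mulEquiv_of_hasEnoughRootsOfUnity B ℂ
  have : Finite (B →* A) := DFunLike.finite _
  let D : (A →* B) → (B →* A) := fun f =>
    (eA.toMonoidHom.comp (MonoidHom.compHom' f)).comp eB.symm.toMonoidHom
  refine Nat.card_le_card_of_injective D fun f g h => ?_
  ext a
  rw [← CommGroup.forall_apply_eq_apply_iff B (M := ℂ)]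
  intro χ
  have h1 := DFunLike.congr_fun h (eB χ)
  simp only [D, MonoidHom.comp_apply, MulEquiv.toMonoidHom_eq_coe, MonoidHom.coe_coe,
    MulEquiv.symm_apply_apply, EmbeddingLike.apply_eq_iff_eq] at h1
  exact DFunLike.congr_fun h1 a

theorem natCard_addMonoidHom_comm (K W : Type*) [AddCommGroup K] [AddCommGroup W] [Finite K]
    [Finite W] : Nat.card (K →+ W) = Nat.card (W →+ K) := by
  rw [Nat.card_congr (AddMonoidHom.toMultiplicative (α := K) (β := W)),
    Nat.card_congr (AddMonoidHom.toMultiplicative (α := W) (β := K))]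
  exact le_antisymm natCard_monoidHom_le natCard_monoidHom_le

variable {G : Type*} [AddCommGroup G]

theorem TorsionWiseFinite.finite_ker (hfin : TorsionWiseFinite G) {n : ℕ} (hn : 0 < n) :
    Finite (nsmulAddMonoidHom n : G →+ G).ker :=
  (hfin n hn).to_subtype

/-- Homomorphisms to `G` from a group killed by `n` land in the `n`-torsion. -/
def homKerEquiv {K : Type*} [AddCommGroup K] {n : ℕ} (hK : ∀ k : K, n • k = 0) :
    (K →+ G) ≃ (K →+ (nsmulAddMonoidHom n : G →+ G).ker) where
  toFun φ := φ.codRestrict _ fun k => by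
    rw [AddMonoidHom.mem_ker, nsmulAddMonoidHom_apply, ← map_nsmul, hK, map_zero]
  invFun φ := (AddSubgroup.subtype _).comp φ
  left_inv φ := by ext; rfl
  right_inv φ := by ext; rfl

theorem TorsionWiseFinite.natCard_hom (hfin : TorsionWiseFinite G) {n : ℕ} (hn : 0 < n)
    {K : Type*} [AddCommGroup K] [Finite K] (hK : ∀ k : K, n • k = 0) :
    Nat.card (K →+ G) = Nat.card ((nsmulAddMonoidHom n : G →+ G).ker →+ K) := by
  have := hfin.finite_ker hn
  rw [Nat.card_congr (homKerEquiv hK), natCard_addMonoidHom_comm]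

/-- Maps out of varying subgroups `Q` have no common home; after dualizing, all of them are maps
from one fixed torsion group of `G` to `Q'`, selected by a condition on values. -/
theorem TorsionWiseFinite.natCard_hom_subgroup (hfin : TorsionWiseFinite G) {B : Type*}
    [AddCommGroup B] {Q Q' : AddSubgroup B} [Finite Q'] (hle : Q ≤ Q') :
    Nat.card (Q →+ G) = Nat.card
      {ψ : (nsmulAddMonoidHom (Nat.card Q') : G →+ G).ker →+ Q' // ∀ w, (ψ w : B) ∈ Q} := by
  have : Finite Q := Finite.of_injective _ (AddSubgroup.inclusion_injective hle)
  rw [hfin.natCard_hom (Nat.card_pos (α := Q')) fun k => AddSubgroup.inclusion_injective hle (by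
      rw [map_nsmul, map_zero, card_nsmul_eq_zero'])]
  exact Nat.card_congr
    { toFun := fun ψ => ⟨(AddSubgroup.inclusion hle).comp ψ, fun w => (ψ w).2⟩
      invFun := fun ψ =>
        { toFun := fun w => ⟨ψ.1 w, ψ.2 w⟩
          map_zero' := Subtype.ext (by simp)
          map_add' := fun _ _ => Subtype.ext (by simp) }
      left_inv := fun _ => rfl
      right_inv := fun _ => rfl }

theorem TorsionWiseFinite.finite_hom (hfin : TorsionWiseFinite G) (K : Type*) [AddCommGroup K]
    [Finite K] : Finite (K →+ G) := by
  have := hfin.finite_ker (Nat.card_pos (α := K))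
  have : Finite (K →+ (nsmulAddMonoidHom (Nat.card K) : G →+ G).ker) := DFunLike.finite _
  exact Finite.of_equiv _ (homKerEquiv fun k => card_nsmul_eq_zero').symm

theorem IsDivisible.baer (hdiv : IsDivisible G) : Module.Baer ℤ G := by
  have : DivisibleBy G ℤ := divisibleByOfSMulRightSurj G ℤ fun {n} hn g => by
    -- Only positive integers may be divided by, so the sign of `n` is moved onto `g`.
    obtain ⟨g', hg'⟩ := hdiv n.natAbs (Int.natAbs_pos.2 hn) (n.sign • g)
    refine ⟨g', ?_⟩
    have hs : n.sign * n.sign = 1 := by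
      rw [← Int.sign_mul, Int.sign_eq_one_of_pos (mul_self_pos.2 hn)]
    simp only at hg' ⊢
    rw [← Int.sign_mul_natAbs n, mul_smul, natCast_zsmul, hg', ← mul_smul, hs, one_smul]
  exact Module.Baer.of_divisible G

end FiniteHom

/-! ### Maps killing a subgroup, and saturations -/

section Killing

variable {Γ : Type*} [AddCommGroup Γ] (G : Type*) [AddCommGroup G]

/-- The homomorphisms from the subgroup `M` to `G` that kill `M ⊓ L`. -/
def killing (M L : AddSubgroup Γ) : AddSubgroup (M →+ G) where
  carrier := {φ | ∀ x : M, (x : Γ) ∈ L → φ x = 0}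
  zero_mem' _ _ := rfl
  add_mem' ha hb x hx := by rw [AddMonoidHom.add_apply, ha x hx, hb x hx, add_zero]
  neg_mem' ha x hx := by rw [AddMonoidHom.neg_apply, ha x hx, neg_zero]

variable {G}

theorem mem_killing {M L : AddSubgroup Γ} {φ : M →+ G} :
    φ ∈ killing G M L ↔ ∀ x : M, (x : Γ) ∈ L → φ x = 0 := Iff.rfl

/-- If `p : M → Q` is onto with kernel `M ⊓ L`, the maps killing `M ⊓ L` are the maps `Q → G`. -/
noncomputable def killingEquiv {M L : AddSubgroup Γ} {Q : Type*} [AddCommGroup Q] (p : M →+ Q)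
    (hp : Function.Surjective p) (hker : ∀ x : M, p x = 0 ↔ (x : Γ) ∈ L) :
    killing G M L ≃ (Q →+ G) :=
  (Equiv.subtypeEquivRight fun φ => by
    simp only [mem_killing, SetLike.le_def, AddMonoidHom.mem_ker, hker]).trans
    (AddMonoidHom.liftOfSurjective p hp)

theorem killing_congr {M L L' : AddSubgroup Γ} (h : ∀ x ∈ M, x ∈ L ↔ x ∈ L') :
    killing G M L = killing G M L' := by
  ext φ
  exact forall_congr' fun x => by rw [h x x.2]

/-- `φ` descends to the image of `M` in `Γ ⧸ L`, and extends from there because a divisible group is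
injective. -/
theorem IsDivisible.exists_extension (hdiv : IsDivisible G) {M L : AddSubgroup Γ} {φ : M →+ G}
    (hφ : φ ∈ killing G M L) :
    ∃ ψ : Γ →+ G, (∀ x ∈ L, ψ x = 0) ∧ ∀ x : M, ψ x = φ x := by
  let p : M →+ Γ ⧸ L := (QuotientAddGroup.mk' L).comp M.subtype
  have hp : p.rangeRestrict.ker ≤ φ.ker := fun x hx =>
    hφ x ((QuotientAddGroup.eq_zero_iff _).1 (congrArg Subtype.val hx))
  let φ' : p.range →+ G :=
    AddMonoidHom.liftOfSurjective p.rangeRestrict p.rangeRestrict_surjective ⟨φ, hp⟩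
  obtain ⟨ψ, hψ⟩ := hdiv.baer.extension_property_addMonoidHom p.range.subtype
    p.range.subtype_injective φ'
  refine ⟨ψ.comp (QuotientAddGroup.mk' L), fun x hx => ?_, fun x => ?_⟩
  · rw [AddMonoidHom.comp_apply, QuotientAddGroup.mk'_apply,
      (QuotientAddGroup.eq_zero_iff _).2 hx, map_zero]
  · have h1 := DFunLike.congr_fun hψ (p.rangeRestrict x)
    have h2 : φ' (p.rangeRestrict x) = φ x :=
      AddMonoidHom.liftOfRightInverse_comp_apply _ _ _ ⟨φ, hp⟩ x
    exact h1.trans h2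

/-- Restriction to `M` is onto by the extension property, and its kernel consists of the maps that
kill `M` as well as `L`. -/
theorem IsDivisible.natCard_killing (hdiv : IsDivisible G) {M N : AddSubgroup Γ} (hMN : M ≤ N)
    (L : AddSubgroup Γ) :
    Nat.card (killing G N L) = Nat.card (killing G M L) * Nat.card (killing G N (M ⊔ L)) := by
  let res : killing G N L →+ killing G M L :=
    { toFun := fun φ => ⟨φ.1.comp (AddSubgroup.inclusion hMN), fun x hx => φ.2 _ hx⟩
      map_zero' := rfl
      map_add' := fun _ _ => rfl }
  have hres : Function.Surjective res := fun φ => by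
    obtain ⟨ψ, hψL, hψ⟩ := hdiv.exists_extension φ.2
    exact ⟨⟨ψ.comp N.subtype, fun x hx => hψL x hx⟩, Subtype.ext (AddMonoidHom.ext hψ)⟩
  rw [AddSubgroup.card_eq_card_quotient_mul_card_addSubgroup res.ker,
    Nat.card_congr (QuotientAddGroup.quotientKerEquivOfSurjective res hres).toEquiv]
  congr 1
  refine Nat.card_congr
    { toFun := fun φ => ⟨φ.1.1, fun x hx => ?_⟩
      invFun := fun φ => ⟨⟨φ.1, fun x hx => φ.2 x (AddSubgroup.mem_sup_right hx)⟩, ?_⟩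
      left_inv := fun _ => rfl
      right_inv := fun _ => rfl }
  · obtain ⟨y, hy, z, hz, h⟩ := AddSubgroup.mem_sup.1 hx
    -- Modular law: `M ≤ N` puts the `L`-component of `x` back in `N`, where `φ` is defined.
    have hzN : z ∈ N := by
      rw [← add_sub_cancel_left y z, h]
      exact N.sub_mem x.2 (hMN hy)
    have h1 : φ.1.1 ⟨y, hMN hy⟩ = 0 :=
      DFunLike.congr_fun (congrArg Subtype.val φ.2) (⟨y, hy⟩ : M)
    have h2 : φ.1.1 ⟨z, hzN⟩ = 0 := φ.1.2 _ hz
    have h3 : x = ⟨y, hMN hy⟩ + ⟨z, hzN⟩ := Subtype.ext h.symm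
    rw [h3, map_add, h1, h2, add_zero]
  · refine Subtype.ext (AddMonoidHom.ext fun x => ?_)
    exact φ.2 _ (AddSubgroup.mem_sup_left x.2)

/-- The elements of `Γ` with a positive multiple in `L`. -/
def saturation (L : AddSubgroup Γ) : AddSubgroup Γ :=
  (AddCommGroup.torsion (Γ ⧸ L)).comap (QuotientAddGroup.mk' L)

theorem mem_saturation {L : AddSubgroup Γ} {z : Γ} :
    z ∈ saturation L ↔ ∃ n : ℕ, 0 < n ∧ n • z ∈ L := by
  rw [saturation, AddSubgroup.mem_comap, AddCommGroup.mem_torsion,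
    isOfFinAddOrder_iff_nsmul_eq_zero]
  refine exists_congr fun n => and_congr_right fun _ => ?_
  rw [← map_nsmul]
  exact QuotientAddGroup.eq_zero_iff _

theorem le_saturation (L : AddSubgroup Γ) : L ≤ saturation L := fun z hz =>
  mem_saturation.2 ⟨1, one_pos, by rwa [one_nsmul]⟩

theorem saturation_mono {L L' : AddSubgroup Γ} (h : L ≤ L') : saturation L ≤ saturation L' :=
  fun _ hz => by
    obtain ⟨n, hn, hz⟩ := mem_saturation.1 hz
    exact mem_saturation.2 ⟨n, hn, h hz⟩

theorem saturation_le_of_le {L L' : AddSubgroup Γ} (h : L' ≤ saturation L) :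
    saturation L' ≤ saturation L := fun z hz => by
  obtain ⟨n, hn, hz⟩ := mem_saturation.1 hz
  obtain ⟨k, hk, hz⟩ := mem_saturation.1 (h hz)
  exact mem_saturation.2 ⟨k * n, Nat.mul_pos hk hn, by rwa [mul_nsmul']⟩

/-- The maps from the saturation of `L` to `G` killing `L` are the maps from the torsion of
`Γ ⧸ L` to `G`. -/
noncomputable def killingSaturationEquiv (L : AddSubgroup Γ) :
    killing G (saturation L) L ≃ (AddCommGroup.torsion (Γ ⧸ L) →+ G) :=
  killingEquiv ((QuotientAddGroup.mk' L).addSubgroupComap _)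
    (AddMonoidHom.addSubgroupComap_surjective_of_surjective _ _
      (QuotientAddGroup.mk'_surjective L)) fun x => by
    rw [Subtype.ext_iff]
    exact QuotientAddGroup.eq_zero_iff _

theorem fg_addSubgroup {B : Type*} [AddCommGroup B] [AddGroup.FG B] (H : AddSubgroup B) :
    AddGroup.FG H := by
  have : Module.Finite ℤ B := Module.Finite.iff_addGroup_fg.2 inferInstance
  have : Module.Finite ℤ (AddSubgroup.toIntSubmodule H) := inferInstance
  exact Module.Finite.iff_addGroup_fg.1 this

theorem TorsionWiseFinite.finite_killing [AddGroup.FG Γ] (hfin : TorsionWiseFinite G)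
    (L : AddSubgroup Γ) : Finite (killing G (saturation L) L) := by
  have := fg_addSubgroup (AddCommGroup.torsion (Γ ⧸ L))
  have := AddCommGroup.finite_of_fg_isAddTorsion (AddCommGroup.torsion (Γ ⧸ L))
    fun x => AddSubmonoid.isOfFinAddOrder_coe.1 x.2
  have := hfin.finite_hom (AddCommGroup.torsion (Γ ⧸ L))
  exact Finite.of_equiv _ (killingSaturationEquiv L).symm

end Killing

/-! ### The rank of spans as a matroid rank function -/

section Rank

open Finset

variable {ι Γ : Type*} [AddCommGroup Γ] (A : ι → Γ)

theorem multiplicity_eq_natCard_killing (G : Type*) [AddCommGroup G] (S : Finset ι) :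
    multiplicity A G S = Nat.card (killing G (saturation (spanOf A S)) (spanOf A S)) :=
  (Nat.card_congr (killingSaturationEquiv _)).symm

theorem mem_spanOf {S : Finset ι} {e : ι} (he : e ∈ S) : A e ∈ spanOf A S :=
  AddSubgroup.subset_closure ⟨e, he, rfl⟩

theorem spanOf_mono {S S' : Finset ι} (h : S ⊆ S') : spanOf A S ≤ spanOf A S' :=
  AddSubgroup.closure_mono (Set.image_mono h)

theorem spanOf_le {S : Finset ι} {L : AddSubgroup Γ} (h : ∀ e ∈ S, A e ∈ L) : spanOf A S ≤ L := by
  rw [spanOf, AddSubgroup.closure_le]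
  rintro _ ⟨e, he, rfl⟩
  exact h e he

variable [DecidableEq ι]

theorem mem_spanOf_insert {e : ι} {S : Finset ι} {z : Γ} :
    z ∈ spanOf A (insert e S) ↔ ∃ n : ℤ, z - n • A e ∈ spanOf A S := by
  rw [spanOf, coe_insert, Set.image_insert_eq, ← Set.singleton_union, AddSubgroup.closure_union,
    AddSubgroup.mem_sup]
  simp only [AddSubgroup.mem_closure_singleton]
  constructor
  · rintro ⟨_, ⟨n, rfl⟩, z', hz', rfl⟩
    exact ⟨n, by rwa [add_sub_cancel_left]⟩
  · rintro ⟨n, hn⟩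
    exact ⟨n • A e, ⟨n, rfl⟩, _, hn, by abel⟩

omit [DecidableEq ι] in
theorem finite_toIntSubmodule_spanOf (S : Finset ι) :
    Module.Finite ℤ (AddSubgroup.toIntSubmodule (spanOf A S)) := by
  rw [spanOf, AddSubgroup.toIntSubmodule_closure]
  exact Module.Finite.span_of_finite ℤ (S.finite_toSet.image A)

/-- The quotient of the two spans is generated by the class of `A e`; its rank is at most one, and
zero exactly when that class is torsion. -/
theorem rk_insert (e : ι) (S : Finset ι) :
    rk A S ≤ rk A (insert e S) ∧ rk A (insert e S) ≤ rk A S + 1 ∧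
      (rk A (insert e S) = rk A S ↔ A e ∈ saturation (spanOf A S)) := by
  let M := AddSubgroup.toIntSubmodule (spanOf A (insert e S))
  let N := (AddSubgroup.toIntSubmodule (spanOf A S)).submoduleOf M
  have hle : AddSubgroup.toIntSubmodule (spanOf A S) ≤ M := spanOf_mono A (subset_insert e S)
  have hN : Module.finrank ℤ N = rk A S := (Submodule.submoduleOfEquivOfLe hle).finrank_eq
  have : Module.Finite ℤ M := finite_toIntSubmodule_spanOf A (insert e S)
  have hadd : Module.finrank ℤ (M ⧸ N) + Module.finrank ℤ N = rk A (insert e S) :=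
    Submodule.finrank_quotient_add_finrank N
  let v : M := ⟨A e, mem_spanOf A (mem_insert_self e S)⟩
  have hgen : ∀ x : M, ∃ n : ℤ, n • N.mkQ v = N.mkQ x := fun x => by
    obtain ⟨n, hn⟩ := (mem_spanOf_insert A).1 x.2
    refine ⟨n, ?_⟩
    rw [← map_smul, eq_comm, ← sub_eq_zero, ← map_sub, Submodule.mkQ_apply,
      Submodule.Quotient.mk_eq_zero]
    exact hn
  have hone : Module.finrank ℤ (M ⧸ N) ≤ 1 :=
    finrank_le_one (N.mkQ v) fun w => by
      obtain ⟨x, rfl⟩ := N.mkQ_surjective w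
      exact hgen x
  have hzero : Module.finrank ℤ (M ⧸ N) = 0 ↔ A e ∈ saturation (spanOf A S) := by
    rw [Module.finrank_eq_zero_iff, mem_saturation]
    constructor
    · intro h
      obtain ⟨a, ha, h⟩ := h (N.mkQ v)
      rw [← map_smul, Submodule.mkQ_apply, Submodule.Quotient.mk_eq_zero] at h
      have h' : a • A e ∈ spanOf A S := h
      refine ⟨a.natAbs, Int.natAbs_pos.2 ha, ?_⟩
      rw [← natCast_zsmul, Int.natCast_natAbs]
      rcases abs_choice a with h1 | h1 <;> rw [h1]
      · exact h'
      · rw [neg_smul]; exact neg_mem h'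
    · rintro ⟨n, hn, h⟩ w
      obtain ⟨x, rfl⟩ := N.mkQ_surjective w
      obtain ⟨k, hk⟩ := hgen x
      refine ⟨n, by exact_mod_cast hn.ne', ?_⟩
      rw [← hk, smul_comm, ← map_smul, Submodule.mkQ_apply,
        (Submodule.Quotient.mk_eq_zero N).2, smul_zero]
      change ((n : ℤ) • A e) ∈ spanOf A S
      rwa [natCast_zsmul]
  rw [← hzero]
  omega

theorem isRankFunction_rk : IsRankFunction (rk A) where
  empty := Nat.le_zero.1 (rk_le_card A ∅)
  le_insert e S := (rk_insert A e S).1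
  insert_le e S := (rk_insert A e S).2.1
  insert_eq e S S' h := by
    rw [(rk_insert A e S).2.2, (rk_insert A e S').2.2]
    exact fun he => saturation_mono (spanOf_mono A h) he

end Rank

/-- The class of `z` generates a copy of `ℤ` in `Γ ⧸ L`; the inclusion of `ℤ` in the injective group
`ℚ` extends along it. -/
theorem exists_functional {Γ : Type*} [AddCommGroup Γ] {L : AddSubgroup Γ} {z : Γ}
    (hz : z ∉ saturation L) : ∃ c : Γ →+ ℚ, c z = 1 ∧ ∀ x ∈ L, c x = 0 := by
  let f : ℤ →+ Γ ⧸ L := zmultiplesHom (Γ ⧸ L) (QuotientAddGroup.mk' L z)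
  have hf : Function.Injective f := by
    rw [injective_iff_map_eq_zero]
    intro n hn
    by_contra h0
    refine hz (mem_saturation.2 ⟨n.natAbs, Int.natAbs_pos.2 h0, ?_⟩)
    have h1 : n • z ∈ L := by
      rw [← QuotientAddGroup.eq_zero_iff]
      exact hn
    rw [← natCast_zsmul, Int.natCast_natAbs]
    rcases abs_choice n with h | h <;> rw [h]
    · exact h1
    · rw [neg_smul]; exact neg_mem h1
  obtain ⟨c, hc⟩ := (Module.Baer.of_divisible ℚ).extension_property_addMonoidHom f hf
    (Int.castAddHom ℚ)
  refine ⟨c.comp (QuotientAddGroup.mk' L), ?_, fun x hx => ?_⟩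
  · have := DFunLike.congr_fun hc 1
    simpa [f] using this
  · rw [AddMonoidHom.comp_apply, QuotientAddGroup.mk'_apply,
      (QuotientAddGroup.eq_zero_iff _).2 hx, map_zero]

/-! ### Rational coordinates along the coloops -/

section Coordinates

variable {ι Γ : Type*} [DecidableEq ι] [AddCommGroup Γ]

/-- Rational functionals dual to the vectors indexed by `F`, modulo the other vectors of `S`. -/
structure IsCoordinates (A : ι → Γ) (S F : Finset ι) (c : ι → Γ →+ ℚ) : Prop where
  subset : F ⊆ S
  apply_self : ∀ f ∈ F, c f (A f) = 1
  apply_span : ∀ f ∈ F, ∀ z ∈ spanOf A (S.erase f), c f z = 0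
  apply_notMem : ∀ f ∉ F, c f = 0

theorem exists_isCoordinates {A : ι → Γ} {S F : Finset ι} (hFS : F ⊆ S)
    (hF : ∀ e ∈ F, rk A (S.erase e) ≠ rk A S) : ∃ c, IsCoordinates A S F c := by
  have h : ∀ f, ∃ c : Γ →+ ℚ, (f ∈ F → c (A f) = 1 ∧ ∀ z ∈ spanOf A (S.erase f), c z = 0) ∧
      (f ∉ F → c = 0) := fun f => by
    by_cases hf : f ∈ F
    · have h1 : A f ∉ saturation (spanOf A (S.erase f)) := by
        rw [← (rk_insert A f (S.erase f)).2.2, insert_erase (hFS hf)]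
        exact (hF f hf).symm
      obtain ⟨c, hc⟩ := exists_functional h1
      exact ⟨c, fun _ => hc, fun h => absurd hf h⟩
    · exact ⟨0, fun h => absurd h hf, fun _ => rfl⟩
  choose c hc using h
  exact ⟨c, hFS, fun f hf => ((hc f).1 hf).1, fun f hf => ((hc f).1 hf).2, fun f => (hc f).2⟩

/-- The coordinates modulo integers. -/
def circleCoord (c : ι → Γ →+ ℚ) : Γ →+ (ι → AddCircle (1 : ℚ)) :=
  AddMonoidHom.pi fun f => (QuotientAddGroup.mk' _).comp (c f)

omit [DecidableEq ι] in
theorem circleCoord_eq_zero_iff {c : ι → Γ →+ ℚ} {z : Γ} {f : ι} :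
    circleCoord c z f = 0 ↔ ∃ n : ℤ, (n : ℚ) = c f z := by
  have : circleCoord c z f = ((c f z : ℚ) : AddCircle (1 : ℚ)) := rfl
  rw [this, AddCircle.coe_eq_zero_iff]
  simp

namespace IsCoordinates

variable {A : ι → Γ} {S F : Finset ι} {c : ι → Γ →+ ℚ} (hc : IsCoordinates A S F c)
include hc

theorem apply_eq_zero_of_mem_saturation {S' : Finset ι} (hS' : S' ⊆ S) {f : ι} (hf : f ∉ S')
    {z : Γ} (hz : z ∈ saturation (spanOf A S')) : c f z = 0 := by
  by_cases hfF : f ∈ F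
  · obtain ⟨n, hn, hz⟩ := mem_saturation.1 hz
    have h := hc.apply_span f hfF _ (spanOf_mono A (subset_erase.2 ⟨hS', hf⟩) hz)
    rw [map_nsmul, nsmul_eq_mul, mul_eq_zero] at h
    exact h.resolve_left (by exact_mod_cast hn.ne')
  · rw [hc.apply_notMem f hfF, AddMonoidHom.zero_apply]

theorem apply_of_ne {f g : ι} (hg : g ∈ S) (hne : g ≠ f) : c f (A g) = 0 :=
  hc.apply_eq_zero_of_mem_saturation (erase_subset f S) (notMem_erase f S)
    (le_saturation _ (mem_spanOf A (mem_erase.2 ⟨hne, hg⟩)))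

theorem circleCoord_eq_zero {z : Γ} (hz : z ∈ spanOf A S) : circleCoord c z = 0 := by
  have h : spanOf A S ≤ (circleCoord c).ker := spanOf_le A fun e he => by
    rw [AddMonoidHom.mem_ker]
    funext f
    rw [Pi.zero_apply, circleCoord_eq_zero_iff]
    by_cases hfe : e = f
    · subst hfe
      by_cases hf : e ∈ F
      · exact ⟨1, by rw [hc.apply_self e hf, Int.cast_one]⟩
      · exact ⟨0, by rw [hc.apply_notMem e hf, Int.cast_zero, AddMonoidHom.zero_apply]⟩
    · exact ⟨0, by rw [hc.apply_of_ne he hfe, Int.cast_zero]⟩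
  exact h hz

/-- On the span, `c f` reads off the integer coefficient of `A f`, so where it vanishes that vector
can be dropped. -/
theorem mem_spanOf_sdiff {S' X : Finset ι} (hS' : S' ⊆ S) (hX : X ⊆ F) {z : Γ}
    (hz : z ∈ spanOf A S') (h0 : ∀ f ∈ X, c f z = 0) : z ∈ spanOf A (S' \ X) := by
  induction X using Finset.induction_on with
  | empty => rwa [sdiff_empty]
  | insert f X _ ih =>
    have h1 := ih ((subset_insert _ _).trans hX) fun g hg => h0 g (mem_insert_of_mem hg)
    rw [sdiff_insert]
    by_cases hf : f ∈ S' \ X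
    · rw [← insert_erase hf] at h1
      obtain ⟨n, hn⟩ := (mem_spanOf_insert A).1 h1
      have h2 := hc.apply_eq_zero_of_mem_saturation
        (((erase_subset _ _).trans sdiff_subset).trans hS') (notMem_erase f _) (le_saturation _ hn)
      rw [map_sub, map_zsmul, hc.apply_self f (hX (mem_insert_self _ _)),
        h0 f (mem_insert_self _ _), zero_sub, neg_eq_zero, zsmul_eq_mul, mul_one,
        Int.cast_eq_zero] at h2
      rwa [h2, zero_smul, sub_zero] at hn
    · rwa [erase_eq_of_notMem hf]

theorem mem_saturation_sdiff {S' X : Finset ι} (hS' : S' ⊆ S) (hX : X ⊆ F) {z : Γ}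
    (hz : z ∈ saturation (spanOf A S')) (h0 : ∀ f ∈ X, c f z = 0) :
    z ∈ saturation (spanOf A (S' \ X)) := by
  obtain ⟨n, hn, hz⟩ := mem_saturation.1 hz
  exact mem_saturation.2 ⟨n, hn, hc.mem_spanOf_sdiff hS' hX hz fun f hf => by
    rw [map_nsmul, h0 f hf, smul_zero]⟩

theorem exists_mem_spanOf {X : Finset ι} (hX : X ⊆ F) {z : Γ}
    (hz : ∀ f ∈ X, circleCoord c z f = 0) : ∃ y ∈ spanOf A X, ∀ f ∈ X, c f (z - y) = 0 := by
  have h : ∀ f, ∃ n : ℤ, f ∈ X → (n : ℚ) = c f z := fun f => by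
    by_cases hf : f ∈ X
    · obtain ⟨n, hn⟩ := circleCoord_eq_zero_iff.1 (hz f hf)
      exact ⟨n, fun _ => hn⟩
    · exact ⟨0, fun h => absurd h hf⟩
  choose n hn using h
  refine ⟨∑ g ∈ X, n g • A g,
    sum_mem fun g hg => zsmul_mem (mem_spanOf A hg) _, fun f hf => ?_⟩
  rw [map_sub, map_sum, sum_eq_single_of_mem f hf, map_zsmul, hc.apply_self f (hX hf),
    zsmul_eq_mul, mul_one, hn f hf, sub_self]
  intro g hg hne
  rw [map_zsmul, hc.apply_of_ne (hc.subset (hX hg)) hne, smul_zero]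

variable {R T : Finset ι} (hS : R ∪ F ∪ T = S) (hRF : Disjoint R F)
include hS hRF

/-- Coordinates in `F \ X` that vanish modulo integers are made zero by subtracting a combination of
vectors of `F`, which `circleCoord` does not see. -/
theorem mem_map_saturation_iff {X : Finset ι} (hX : X ⊆ F) {q : ι → AddCircle (1 : ℚ)} :
    q ∈ (saturation (spanOf A (R ∪ X))).map (circleCoord c) ↔
      q ∈ (saturation (spanOf A (R ∪ F))).map (circleCoord c) ∧ ∀ f ∈ F \ X, q f = 0 := by
  have hRFS : R ∪ F ⊆ S := hS ▸ subset_union_left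
  constructor
  · rintro ⟨z, hz, rfl⟩
    refine ⟨⟨z, saturation_mono (spanOf_mono A (union_subset_union_right hX)) hz, rfl⟩,
      fun f hf => circleCoord_eq_zero_iff.2 ⟨0, ?_⟩⟩
    rw [hc.apply_eq_zero_of_mem_saturation ((union_subset_union_right hX).trans hRFS) ?_ hz,
      Int.cast_zero]
    rw [mem_sdiff] at hf
    rw [notMem_union]
    exact ⟨fun h => disjoint_left.1 hRF h hf.1, hf.2⟩
  · rintro ⟨⟨z, hz, rfl⟩, h0⟩
    obtain ⟨y, hy, hzy⟩ := hc.exists_mem_spanOf sdiff_subset h0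
    have hy' : y ∈ spanOf A (R ∪ F) :=
      spanOf_mono A (sdiff_subset.trans subset_union_right) hy
    refine ⟨z - y, ?_, ?_⟩
    · have h1 := hc.mem_saturation_sdiff hRFS sdiff_subset
        (sub_mem hz (le_saturation _ hy')) hzy
      refine saturation_mono (spanOf_mono A fun x hx => ?_) h1
      simp only [mem_sdiff, mem_union] at hx ⊢
      tauto
    · rw [map_sub, hc.circleCoord_eq_zero (spanOf_mono A hRFS hy'), sub_zero]

/-- An element with integral coordinates is a combination of the vectors of `X` plus an element of
the saturation with all `X`-coordinates zero, which lies over `R` alone. -/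
theorem circleCoord_eq_zero_iff_mem_sup {X Y : Finset ι} (hX : X ⊆ F) (hY : Y ⊆ T) {z : Γ}
    (hz : z ∈ saturation (spanOf A (R ∪ X))) :
    circleCoord c z = 0 ↔ z ∈ saturation (spanOf A R) ⊔ spanOf A (R ∪ X ∪ Y) := by
  constructor
  · intro h0
    obtain ⟨y, hy, hzy⟩ := hc.exists_mem_spanOf hX (z := z) fun f _ => congrFun h0 f
    have hy' : y ∈ spanOf A (R ∪ X) := spanOf_mono A subset_union_right hy
    have h1 := hc.mem_saturation_sdiff
      ((union_subset_union_right hX).trans (hS ▸ subset_union_left)) hX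
      (sub_mem hz (le_saturation _ hy')) hzy
    refine AddSubgroup.mem_sup.2 ⟨z - y, ?_, y, spanOf_mono A subset_union_left hy',
      sub_add_cancel z y⟩
    refine saturation_mono (spanOf_mono A fun x hx => ?_) h1
    simp only [mem_sdiff, mem_union] at hx
    tauto
  · intro h
    obtain ⟨x, hx, y, hy, rfl⟩ := AddSubgroup.mem_sup.1 h
    have hle : R ∪ X ∪ Y ⊆ S := by
      rw [← hS]
      exact union_subset_union (union_subset_union_right hX) hY
    rw [map_add, hc.circleCoord_eq_zero (spanOf_mono A hle hy), add_zero]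
    funext f
    refine circleCoord_eq_zero_iff.2 ⟨0, ?_⟩
    rw [Int.cast_zero]
    by_cases hf : f ∈ F
    · exact (hc.apply_eq_zero_of_mem_saturation
        (subset_union_left.trans (subset_union_left.trans hle))
        (fun h => disjoint_left.1 hRF h hf) hx).symm
    · rw [hc.apply_notMem f hf, AddMonoidHom.zero_apply]

/-- All coordinates vanish on the saturation of `⟨R⟩`, so the vectors of `X` contribute nothing
there. -/
theorem mem_spanOf_iff {X Y : Finset ι} (hX : X ⊆ F) (hY : Y ⊆ T) {z : Γ}
    (hz : z ∈ saturation (spanOf A R)) :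
    z ∈ spanOf A (R ∪ X ∪ Y) ↔ z ∈ spanOf A (R ∪ Y) := by
  have hle : R ∪ X ∪ Y ⊆ S := by
    rw [← hS]
    exact union_subset_union (union_subset_union_right hX) hY
  constructor
  · intro h
    have h1 := hc.mem_spanOf_sdiff hle hX h fun f hf =>
      hc.apply_eq_zero_of_mem_saturation (subset_union_left.trans (subset_union_left.trans hle))
        (fun h => disjoint_left.1 hRF h (hX hf)) hz
    refine spanOf_mono A (fun x hx => ?_) h1
    simp only [mem_sdiff, mem_union] at hx ⊢
    tauto
  · exact fun h => spanOf_mono A (union_subset_union_left subset_union_left) h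

omit hRF in
theorem finite_map_saturation [AddGroup.FG Γ] :
    Finite ((saturation (spanOf A (R ∪ F))).map (circleCoord c)) := by
  have := fg_addSubgroup (saturation (spanOf A (R ∪ F)))
  have := AddGroup.fg_of_surjective
    ((circleCoord c).addSubgroupMap_surjective (saturation (spanOf A (R ∪ F))))
  refine AddCommGroup.finite_of_fg_isAddTorsion _ ?_
  rintro ⟨_, z, hz, rfl⟩
  obtain ⟨n, hn, hz⟩ := mem_saturation.1 hz
  refine isOfFinAddOrder_iff_nsmul_eq_zero.2 ⟨n, hn, Subtype.ext ?_⟩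
  change n • circleCoord c z = 0
  rw [← map_nsmul, hc.circleCoord_eq_zero (spanOf_mono A (hS ▸ subset_union_left) hz)]

end IsCoordinates

end Coordinates

/-! ### Factorization of the multiplicity on a molecule -/

section Molecule

variable {ι Γ G : Type*} [DecidableEq ι] [AddCommGroup Γ] [AddCommGroup G]

/-- Maps killing the span of `R ∪ Y` are the maps killing the span of `R` and each vector
indexed by `Y`. -/
def killingUnionEquiv (A : ι → Γ) (M : AddSubgroup Γ) (R Y : Finset ι)
    (hM : spanOf A (R ∪ Y) ≤ M) :
    killing G M (spanOf A (R ∪ Y)) ≃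
      {φ : killing G M (spanOf A R) // ∀ y ∈ Y, ∀ h : A y ∈ M, φ.1 ⟨A y, h⟩ = 0} where
  toFun φ := ⟨⟨φ.1, fun x hx => φ.2 x (spanOf_mono A subset_union_left hx)⟩,
    fun _ hy _ => φ.2 _ (mem_spanOf A (mem_union_right _ hy))⟩
  invFun φ := ⟨φ.1.1, fun x hx => by
    have h : spanOf A (R ∪ Y) ≤ φ.1.1.ker.map M.subtype := spanOf_le A fun e he => by
      have heM := hM (mem_spanOf A he)
      refine ⟨⟨A e, heM⟩, ?_, rfl⟩
      rcases mem_union.1 he with he | he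
      · exact φ.1.2 _ (mem_spanOf A he)
      · exact φ.2 e he heM
    obtain ⟨x', hx', hxx'⟩ := h hx
    rw [← Subtype.ext hxx']
    exact hx'⟩
  left_inv _ := rfl
  right_inv _ := rfl

theorem exists_countsSupersets_multiplicity [AddGroup.FG Γ] (A : ι → Γ)
    (hfin : TorsionWiseFinite G) (hdiv : IsDivisible G) (R S F T : Finset ι)
    (hF : ∀ e ∈ F, rk A (S.erase e) ≠ rk A S) (hT : ∀ e ∈ T, rk A (insert e R) = rk A R)
    (hS : R ∪ F ∪ T = S) (hRF : Disjoint R F) :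
    ∃ a b : Finset ι → ℕ, CountsSupersets F a ∧ CountsSupersets T b ∧
      ∀ X ⊆ F, ∀ Y ⊆ T, multiplicity A G (R ∪ X ∪ Y) = a (F \ X) * b Y := by
  classical
  obtain ⟨c, hc⟩ := exists_isCoordinates (A := A)
    (show F ⊆ S from hS ▸ subset_union_right.trans subset_union_left) hF
  replace hT : ∀ e ∈ T, A e ∈ saturation (spanOf A R) := fun e he =>
    (rk_insert A e R).2.2.1 (hT e he)
  have hQ := hc.finite_map_saturation hS
  let Q : Finset ι → AddSubgroup (ι → AddCircle (1 : ℚ)) := fun X =>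
    (saturation (spanOf A (R ∪ X))).map (circleCoord c)
  have hQX : ∀ X ⊆ F, ∀ q, q ∈ Q X ↔ q ∈ Q F ∧ ∀ f ∈ F \ X, q f = 0 := fun X hX q =>
    hc.mem_map_saturation_iff hS hRF hX
  change Finite (Q F) at hQ
  have hn : 0 < Nat.card (Q F) := Nat.card_pos
  -- The exponent comes from the largest group `Q F`, so that one `W` serves every `X`.
  let W := (nsmulAddMonoidHom (Nat.card (Q F)) : G →+ G).ker
  have hW : Finite W := hfin.finite_ker hn
  have hΨ : Finite (W →+ Q F) := DFunLike.finite _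
  have hΦ := hfin.finite_killing (spanOf A R)
  let u : (W →+ Q F) → Finset ι := fun ψ => {f ∈ F | ∀ w, (ψ w : ι → AddCircle (1 : ℚ)) f = 0}
  let t : killing G (saturation (spanOf A R)) (spanOf A R) → Finset ι := fun φ =>
    {y ∈ T | ∀ h : A y ∈ saturation (spanOf A R), φ.1 ⟨A y, h⟩ = 0}
  refine ⟨_, _, countsSupersets_natCard F u fun _ => filter_subset _ _,
    countsSupersets_natCard T t fun _ => filter_subset _ _, fun X hX Y hY => ?_⟩
  -- Loops over `R` do not enlarge saturations.
  have hsat : saturation (spanOf A (R ∪ X ∪ Y)) = saturation (spanOf A (R ∪ X)) := by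
    refine le_antisymm (saturation_le_of_le (spanOf_le A fun e he => ?_))
      (saturation_mono (spanOf_mono A subset_union_left))
    rcases mem_union.1 he with he | he
    · exact le_saturation _ (mem_spanOf A he)
    · exact saturation_mono (spanOf_mono A subset_union_left) (hT e (hY he))
  have hRY : spanOf A (R ∪ Y) ≤ saturation (spanOf A R) := spanOf_le A fun e he => by
    rcases mem_union.1 he with he | he
    · exact le_saturation _ (mem_spanOf A he)
    · exact hT e (hY he)
  have hb : Nat.card (killing G (saturation (spanOf A R)) (spanOf A (R ∪ X ∪ Y)))
      = Nat.card {φ // Y ⊆ t φ} := by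
    rw [killing_congr fun z hz => hc.mem_spanOf_iff hS hRF hX hY hz,
      Nat.card_congr (killingUnionEquiv A _ R Y hRY)]
    refine Nat.card_congr (Equiv.subtypeEquivRight fun φ => ?_)
    simp only [subset_iff, t, mem_filter]
    exact ⟨fun h y hy => ⟨hY hy, h y hy⟩, fun h y hy => (h hy).2⟩
  have ha : Nat.card (killing G (saturation (spanOf A (R ∪ X)))
      (saturation (spanOf A R) ⊔ spanOf A (R ∪ X ∪ Y))) = Nat.card {ψ // F \ X ⊆ u ψ} := by
    have hle : Q X ≤ Q F := fun q hq => ((hQX X hX q).1 hq).1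
    rw [Nat.card_congr (killingEquiv ((circleCoord c).addSubgroupMap _)
      ((circleCoord c).addSubgroupMap_surjective _) fun z => by
        rw [← hc.circleCoord_eq_zero_iff_mem_sup hS hRF hX hY z.2]
        exact Subtype.ext_iff)]
    change Nat.card (Q X →+ G) = _
    have hu : ∀ ψ, F \ X ⊆ u ψ ↔ ∀ w, (ψ w : ι → AddCircle (1 : ℚ)) ∈ Q X := fun ψ => by
      simp only [subset_iff, u, mem_filter]
      constructor
      · exact fun h w => (hQX X hX _).2 ⟨(ψ w).2, fun f hf => (h hf).2 w⟩
      · exact fun h f hf => ⟨(mem_sdiff.1 hf).1, fun w => ((hQX X hX _).1 (h w)).2 f hf⟩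
    rw [hfin.natCard_hom_subgroup hle]
    exact Nat.card_congr (Equiv.subtypeEquivRight fun ψ => (hu ψ).symm)
  -- The multiplicity splits along the saturation of `⟨R⟩` inside that of `⟨R ∪ X⟩`.
  rw [multiplicity_eq_natCard_killing, hsat,
    hdiv.natCard_killing (saturation_mono (spanOf_mono A (subset_union_left (s₂ := X)))), ha, hb,
    mul_comm]

end Molecule

theorem tuttePolynomial_eq_intervalTutte {ι Γ : Type*} [Fintype ι] [DecidableEq ι]
    [AddCommGroup Γ] (A : ι → Γ) (G : Type*) [AddCommGroup G] :
    tuttePolynomial A G = intervalTutte (rk A) (multiplicity A G) ∅ univ := by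
  have h : Icc ∅ univ = (univ : Finset (Finset ι)) := by
    ext S
    simp
  rw [tuttePolynomial, intervalTutte, h]
  simp

end GTutte

theorem mainTheorem10 {ι Γ G : Type*} [Fintype ι]
    [AddCommGroup Γ] [AddGroup.FG Γ] (A : ι → Γ)
    [AddCommGroup G] (hfin : GTutte.TorsionWiseFinite G) (hdiv : GTutte.IsDivisible G) :
    ∀ d ∈ (GTutte.tuttePolynomial A G).support,
      0 < (GTutte.tuttePolynomial A G).coeff d := by
  classical
  intro d hd
  refine lt_of_le_of_ne ?_ (MvPolynomial.mem_support_iff.1 hd).symm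
  rw [GTutte.tuttePolynomial_eq_intervalTutte]
  exact (GTutte.isRankFunction_rk A).intervalTutte_coeff_nonneg
    (fun R S F T hF hT hS hRF =>
      GTutte.exists_countsSupersets_multiplicity A hfin hdiv R S F T hF hT hS hRF)
    ∅ Finset.univ (Finset.empty_subset _) d
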